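/- Let $V$ be a real vector space with basis $e_1,e_2,e_3$. For $\alpha,\beta\in V^*$ put $\alpha\vee\beta=\frac12(\alpha\otimes\beta+\beta\otimes\alpha)$ and $\alpha\wedge\beta=\frac12(\alpha\otimes\beta-\beta\otimes\alpha)$, and write $\beta_1\beta_2\beta_3\beta_4=\frac1{4!}\sum_{\sigma\in S_4}\beta_{\sigma(1)}\otimes\beta_{\sigma(2)}\otimes\beta_{\sigma(3)}\otimes\beta_{\sigma(4)}$ for the totally symmetric product of one-forms. Let $$W=\{S\in \mathrm{Sym}^2(\mathrm{Sym}^2V^*)\oplus \mathrm{Sym}^2(\Lambda^2V^*) : \tau S=S\}\subset (V^*)^{\otimes 4},\qquad (\tau S)(v_1,v_2,v_3,v_4)=S(v_1,v_4,v_3,v_2),$$ let $\mathcal C_W\subset W$ be the cone of those $S\in W$ that are positive semidefinite as symmetric bilinear forms on $V\otimes V$, and let $\mathcal C_W^*=\{M\in W^* : M(S)\ge 0\ \ \forall S\in\mathcal C_W\}$. Consider the following elements of $\mathcal C_W$: 1. (first kind) $\alpha^4$ with $\alpha\in V^*\setminus\{0\}$; 2. (second kind) $(\alpha_1\vee\alpha_2)^{\otimes2}+(\alpha_1\wedge\alpha_2)^{\otimes2}$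 with $\alpha_1,\alpha_2\in V^*$ linearly independent; 3. (third, or inelastic, kind) $S_{\mathrm{tot}}+2(g^2+d^2-1-dh)\left[(\alpha_2\otimes\alpha_3)^{\otimes2}+(\alpha_3\otimes\alpha_2)^{\otimes2}\right]$ with $\alpha_1,\alpha_2,\alpha_3$ a basis of $V^*$, $g,d,h\in\mathbb R$, $g^2>1-d^2+dh$, and $$\begin{aligned}S_{\mathrm{tot}}=\ &\alpha_1^4+6\alpha_1^2\alpha_2^2+6\alpha_1^2\alpha_3^2+12d\,\alpha_1\alpha_2^2\alpha_3+12g\,\alpha_1\alpha_2\alpha_3^2+4h\,\alpha_1\alpha_3^3+(1+d^2)\alpha_2^4\\&+4dg\,\alpha_2^3\alpha_3+6(1+dh)\alpha_2^2\alpha_3^2+4g(d+h)\alpha_2\alpha_3^3+(1+g^2+h^2)\alpha_3^4.\end{aligned}$$ We say that $M\in W^*$ satisfies the elastic bounds if $M(S)\ge0$ for all $S$ of the first and second kind. Let $\mathbb Z_2^{\,3}$ be the group generated by the reflections $Q_i$ of $V$ ($Q_ie_i=-e_i$ and $Q_ie_j=e_j$ for $j\ne i$), acting on $W$ and $W^*$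 in the induced way, and let $p\colon W\to W^{\mathbb Z_2^{\,3}}$ be the orthogonal projection with respect to the inner product $\langle S,T\rangle=\sum_{i,j,k,l}S(e_i,e_j,e_k,e_l)\,T(e_i,e_j,e_k,e_l)$. An element $x$ of a convex cone $\mathcal C$ is called extremal in $\mathcal C$ if $x\neq0$ and the ray $\mathbb R_{\ge0}\,x$ is a face of $\mathcal C$. **Theorem.** (a) Let $M\in (W^*)^{\mathbb Z_2^{\,3}}$. Then $M\in\mathcal C_W^*$ if and only if $M$ satisfies the elastic bounds. (b) For every $S$ of the third kind, $p(S)$ is not extremal in the cone $\mathcal C_W^{\,\mathbb Z_2^{\,3}}=\mathcal C_W\cap W^{\mathbb Z_2^{\,3}}$. -/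

import Mathlib

set_option maxSynthPendingDepth 3

open scoped TensorProduct
open Module

noncomputable section

namespace PositivityCone

variable {V : Type*} [AddCommGroup V] [Module ℝ V]

/-- Four-tensors in `V* ⊗ V* ⊗ V* ⊗ V*`, viewed as bilinear forms on `V ⊗ V`;
`S(v₁, v₂, v₃, v₄)` is `S (v₁ ⊗ₜ v₂) (v₃ ⊗ₜ v₄)`. -/
abbrev FourTensor (V : Type*) [AddCommGroup V] [Module ℝ V] : Type _ :=
  LinearMap.BilinForm ℝ (V ⊗[ℝ] V)

/-- `Sym² (Sym² V*)`: symmetric bilinear forms on `V ⊗ V` that are symmetric inside each pair. -/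
def symSym (V : Type*) [AddCommGroup V] [Module ℝ V] : Submodule ℝ (FourTensor V) where
  carrier := {S | (∀ x y, S x y = S y x) ∧ ∀ x y, S (TensorProduct.comm ℝ V V x) y = S x y}
  zero_mem' := by simp
  add_mem' := by
    rintro S T ⟨h1, h2⟩ ⟨k1, k2⟩
    exact ⟨fun x y => by simp [h1 x y, k1 x y], fun x y => by simp [h2 x y, k2 x y]⟩
  smul_mem' := by
    rintro c S ⟨h1, h2⟩
    exact ⟨fun x y => by simp [h1 x y], fun x y => by simp [h2 x y]⟩

/-- `Sym² (Λ² V*)`: symmetric bilinear forms on `V ⊗ V` that are alternating inside each pair. -/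
def symAlt (V : Type*) [AddCommGroup V] [Module ℝ V] : Submodule ℝ (FourTensor V) where
  carrier := {S | (∀ x y, S x y = S y x) ∧ ∀ x y, S (TensorProduct.comm ℝ V V x) y = -S x y}
  zero_mem' := by simp
  add_mem' := by
    rintro S T ⟨h1, h2⟩ ⟨k1, k2⟩
    exact ⟨fun x y => by simp [h1 x y, k1 x y], fun x y => by simp [h2 x y, k2 x y]; ring⟩
  smul_mem' := by
    rintro c S ⟨h1, h2⟩
    exact ⟨fun x y => by simp [h1 x y], fun x y => by simp [h2 x y]⟩

/-- The four-tensors with `τ S = S`, where `(τ S)(v₁, v₂, v₃, v₄) = S(v₁, v₄, v₃, v₂)`. -/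
def tauInvariant (V : Type*) [AddCommGroup V] [Module ℝ V] : Submodule ℝ (FourTensor V) where
  carrier := {S | ∀ v₁ v₂ v₃ v₄ : V, S (v₁ ⊗ₜ v₄) (v₃ ⊗ₜ v₂) = S (v₁ ⊗ₜ v₂) (v₃ ⊗ₜ v₄)}
  zero_mem' := by simp
  add_mem' := by
    intro S T h k v₁ v₂ v₃ v₄
    simp [h v₁ v₂ v₃ v₄, k v₁ v₂ v₃ v₄]
  smul_mem' := by
    intro c S h v₁ v₂ v₃ v₄
    simp [h v₁ v₂ v₃ v₄]

/-- The space `W = {S ∈ Sym² (Sym² V*) ⊕ Sym² (Λ² V*) : τ S = S}`. -/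
def W (V : Type*) [AddCommGroup V] [Module ℝ V] : Submodule ℝ (FourTensor V) :=
  (symSym V ⊔ symAlt V) ⊓ tauInvariant V

/-- The cone `C_W` of positive semidefinite elements of `W`. -/
def cone (V : Type*) [AddCommGroup V] [Module ℝ V] : PointedCone ℝ (W V) where
  carrier := {S | ∀ x : V ⊗[ℝ] V, 0 ≤ (S : FourTensor V) x x}
  zero_mem' := by simp
  add_mem' := by
    intro S T h k x
    simpa using add_nonneg (h x) (k x)
  smul_mem' := by
    intro c S h x
    exact mul_nonneg c.2 (h x)

/-- The dual cone `C_W^* = {M ∈ W* : M(S) ≥ 0 for all S ∈ C_W}`. -/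
def dualCone (V : Type*) [AddCommGroup V] [Module ℝ V] : PointedCone ℝ (Dual ℝ (W V)) :=
  PointedCone.dual (Dual.eval ℝ (W V)) (cone V)

/-! ### Elements built from one-forms -/

/-- `α ⊗ β`, as a linear form on `V ⊗ V`. -/
def tens (α β : Dual ℝ V) : Dual ℝ (V ⊗[ℝ] V) :=
  TensorProduct.dualDistrib ℝ V V (α ⊗ₜ β)

/-- `α ∨ β = (α ⊗ β + β ⊗ α) / 2`. -/
def vee (α β : Dual ℝ V) : Dual ℝ (V ⊗[ℝ] V) := (1 / 2 : ℝ) • (tens α β + tens β α)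

/-- `α ∧ β = (α ⊗ β - β ⊗ α) / 2`. -/
def wedge (α β : Dual ℝ V) : Dual ℝ (V ⊗[ℝ] V) := (1 / 2 : ℝ) • (tens α β - tens β α)

/-- `φ ⊗ φ` for `φ ∈ V* ⊗ V*`. -/
def tensorSq (φ : Dual ℝ (V ⊗[ℝ] V)) : FourTensor V := LinearMap.BilinForm.linMulLin φ φ

/-- The totally symmetric product
`β₀ β₁ β₂ β₃ = (1 / 4!) ∑_σ β_{σ 0} ⊗ β_{σ 1} ⊗ β_{σ 2} ⊗ β_{σ 3}`. -/
def symProd (β : Fin 4 → Dual ℝ V) : FourTensor V :=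
  (1 / 24 : ℝ) • ∑ σ : Equiv.Perm (Fin 4),
    LinearMap.BilinForm.linMulLin (tens (β (σ 0)) (β (σ 1))) (tens (β (σ 2)) (β (σ 3)))

/-- First kind: `S = α⁴` with `α ≠ 0`. -/
def IsFirstKind (S : FourTensor V) : Prop :=
  ∃ α : Dual ℝ V, α ≠ 0 ∧ S = symProd ![α, α, α, α]

/-- Second kind: `S = (α₁ ∨ α₂)^{⊗2} + (α₁ ∧ α₂)^{⊗2}` with `α₁, α₂` linearly independent. -/
def IsSecondKind (S : FourTensor V) : Prop :=
  ∃ α₁ α₂ : Dual ℝ V, LinearIndependent ℝ ![α₁, α₂] ∧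
    S = tensorSq (vee α₁ α₂) + tensorSq (wedge α₁ α₂)

/-- The totally symmetric part of an element of the third kind. -/
def thirdTot (α₁ α₂ α₃ : Dual ℝ V) (g d h : ℝ) : FourTensor V :=
  symProd ![α₁, α₁, α₁, α₁]
    + (6 : ℝ) • symProd ![α₁, α₁, α₂, α₂]
    + (6 : ℝ) • symProd ![α₁, α₁, α₃, α₃]
    + (12 * d) • symProd ![α₁, α₂, α₂, α₃]
    + (12 * g) • symProd ![α₁, α₂, α₃, α₃]
    + (4 * h) • symProd ![α₁, α₃, α₃, α₃]
    + (1 + d ^ 2) • symProd ![α₂, α₂, α₂, α₂]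
    + (4 * d * g) • symProd ![α₂, α₂, α₂, α₃]
    + (6 * (1 + d * h)) • symProd ![α₂, α₂, α₃, α₃]
    + (4 * g * (d + h)) • symProd ![α₂, α₃, α₃, α₃]
    + (1 + g ^ 2 + h ^ 2) • symProd ![α₃, α₃, α₃, α₃]

/-- Third (inelastic) kind: for a basis `α₁, α₂, α₃` of `V*` and `g² > 1 - d² + d h`,
`S = S_tot + 2 (g² + d² - 1 - d h) [(α₂ ⊗ α₃)^{⊗2} + (α₃ ⊗ α₂)^{⊗2}]`. -/
def IsThirdKind (S : FourTensor V) : Prop :=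
  ∃ (α : Basis (Fin 3) ℝ (Dual ℝ V)) (g d h : ℝ), g ^ 2 > 1 - d ^ 2 + d * h ∧
    S = thirdTot (α 0) (α 1) (α 2) g d h
      + (2 * (g ^ 2 + d ^ 2 - 1 - d * h)) •
        (tensorSq (tens (α 1) (α 2)) + tensorSq (tens (α 2) (α 1)))

/-- `M` satisfies the elastic bounds: it is nonnegative on all elements of the first and second
kind. -/
def SatisfiesElasticBounds (M : Dual ℝ (W V)) : Prop :=
  ∀ S : W V, IsFirstKind (S : FourTensor V) ∨ IsSecondKind (S : FourTensor V) → 0 ≤ M S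

/-! ### Extremal elements -/

/-- `x` is an extremal element of the cone `C`: `x ∈ C \ {0}` and the ray `ℝ_{≥0} x` is a face. -/
def IsExtremal {E : Type*} [AddCommGroup E] [Module ℝ E] (C : PointedCone ℝ E) (x : E) : Prop :=
  x ∈ C ∧ x ≠ 0 ∧ IsExtreme ℝ (C : Set E) {y | ∃ t : ℝ, 0 ≤ t ∧ y = t • x}

/-! ### The group action -/

/-- The induced map `S ↦ S(f ·, f ·, f ·, f ·)` on four-tensors. -/
def pullback (f : V →ₗ[ℝ] V) : FourTensor V →ₗ[ℝ] FourTensor V where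
  toFun S := S.comp (TensorProduct.map f f) (TensorProduct.map f f)
  map_add' _ _ := by ext; rfl
  map_smul' _ _ := by ext; rfl

@[simp] lemma pullback_apply (f : V →ₗ[ℝ] V) (S : FourTensor V) (x y : V ⊗[ℝ] V) :
    pullback f S x y = S (TensorProduct.map f f x) (TensorProduct.map f f y) := rfl

lemma comm_map (f : V →ₗ[ℝ] V) (x : V ⊗[ℝ] V) :
    TensorProduct.map f f (TensorProduct.comm ℝ V V x)
      = TensorProduct.comm ℝ V V (TensorProduct.map f f x) := by
  induction x with
  | zero => simp
  | tmul a b => simp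
  | add a b ha hb => simp [ha, hb]

lemma pullback_mem_W (f : V →ₗ[ℝ] V) {S : FourTensor V} (hS : S ∈ W V) : pullback f S ∈ W V := by
  obtain ⟨h, ht⟩ := hS
  refine ⟨?_, fun v₁ v₂ v₃ v₄ => ?_⟩
  · obtain ⟨A, ⟨hA1, hA2⟩, B, ⟨hB1, hB2⟩, rfl⟩ := Submodule.mem_sup.1 h
    rw [map_add]
    refine Submodule.add_mem_sup ⟨fun x y => ?_, fun x y => ?_⟩ ⟨fun x y => ?_, fun x y => ?_⟩
    · exact hA1 _ _
    · simp only [pullback_apply, comm_map, hA2]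
    · exact hB1 _ _
    · simp only [pullback_apply, comm_map, hB2]
  · simpa using ht (f v₁) (f v₂) (f v₃) (f v₄)

/-- The representation of `GL(V)` on `W`: `(g · S)(v₁, …, v₄) = S(g⁻¹ v₁, …, g⁻¹ v₄)`. -/
def rep (V : Type*) [AddCommGroup V] [Module ℝ V] : Representation ℝ (V ≃ₗ[ℝ] V) (W V) where
  toFun g := (pullback (g⁻¹ : V ≃ₗ[ℝ] V).toLinearMap).restrict fun _ hS => pullback_mem_W _ hS
  map_one' := by
    ext S : 2
    refine TensorProduct.ext' fun a b => ?_
    refine LinearMap.ext fun y => ?_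
    induction y with
    | zero => simp
    | tmul c d => rfl
    | add c d hc hd => rw [map_add, map_add, hc, hd]
  map_mul' g k := by
    ext S : 2
    refine TensorProduct.ext' fun a b => ?_
    refine LinearMap.ext fun y => ?_
    induction y with
    | zero => simp
    | tmul c d => simp [LinearMap.restrict_apply, mul_inv_rev]
    | add c d hc hd => rw [map_add, map_add, hc, hd]

/-- The reflection `Q_i` with `Q_i e_i = -e_i` and `Q_i e_j = e_j` for `j ≠ i`. -/
def coordReflection (e : Basis (Fin 3) ℝ V) (i : Fin 3) : V ≃ₗ[ℝ] V :=
  LinearEquiv.ofInvolutive (e.constr ℝ fun j => if j = i then -e j else e j) <| by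
    have h : (e.constr ℝ fun j => if j = i then -e j else e j) ∘ₗ
        (e.constr ℝ fun j => if j = i then -e j else e j) = LinearMap.id := by
      refine e.ext fun j => ?_
      rw [LinearMap.comp_apply, Basis.constr_basis]
      by_cases hj : j = i
      · rw [if_pos hj, map_neg, Basis.constr_basis, if_pos hj, neg_neg, LinearMap.id_apply]
      · rw [if_neg hj, Basis.constr_basis, if_neg hj, LinearMap.id_apply]
    exact fun v => LinearMap.congr_fun h v

/-- The group `ℤ₂³` generated by `Q₁, Q₂, Q₃`. -/
def Z2cubed (e : Basis (Fin 3) ℝ V) : Subgroup (V ≃ₗ[ℝ] V) :=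
  Subgroup.closure (Set.range (coordReflection e))

/-- The action of `ℤ₂³` on `W`; its action on `W*` is the dual representation. -/
def repZ2 (e : Basis (Fin 3) ℝ V) : Representation ℝ (Z2cubed e) (W V) :=
  (rep V).comp (Z2cubed e).subtype

/-- The cone of invariant elements of `C_W`. -/
def invariantCone (e : Basis (Fin 3) ℝ V) : PointedCone ℝ (W V) :=
  cone V ⊓ ((repZ2 e).invariants : PointedCone ℝ (W V))

/-! ### The orthogonal projection onto the invariants -/

/-- The inner product `∑ S_{ijkl} T_{ijkl}` on `W` that comes from the inner product on `V` for
which `e` is orthonormal. -/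
def innerW (e : Basis (Fin 3) ℝ V) : LinearMap.BilinForm ℝ (W V) :=
  LinearMap.mk₂ ℝ (fun S T => ∑ i, ∑ j, ∑ k, ∑ l,
      (S : FourTensor V) (e i ⊗ₜ e j) (e k ⊗ₜ e l) * (T : FourTensor V) (e i ⊗ₜ e j) (e k ⊗ₜ e l))
    (by intros; simp [add_mul, Finset.sum_add_distrib])
    (by intros; simp [mul_assoc, Finset.mul_sum])
    (by intros; simp [mul_add, Finset.sum_add_distrib])
    (by intros; simp [mul_left_comm, Finset.mul_sum])

lemma innerW_apply (e : Basis (Fin 3) ℝ V) (S T : W V) :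
    innerW e S T = ∑ i, ∑ j, ∑ k, ∑ l, (S : FourTensor V) (e i ⊗ₜ e j) (e k ⊗ₜ e l)
      * (T : FourTensor V) (e i ⊗ₜ e j) (e k ⊗ₜ e l) := rfl

lemma innerW_symm (e : Basis (Fin 3) ℝ V) (S T : W V) : innerW e S T = innerW e T S := by
  simp only [innerW_apply, mul_comm]

lemma eq_zero_of_innerW_self (e : Basis (Fin 3) ℝ V) (S : W V) (h : innerW e S S = 0) :
    S = 0 := by
  have hz : ∀ i j k l, (S : FourTensor V) (e i ⊗ₜ e j) (e k ⊗ₜ e l) = 0 := by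
    intro i j k l
    rw [innerW_apply] at h
    have n4 : ∀ i j k l, 0 ≤ (S : FourTensor V) (e i ⊗ₜ e j) (e k ⊗ₜ e l)
        * (S : FourTensor V) (e i ⊗ₜ e j) (e k ⊗ₜ e l) := fun i j k l => mul_self_nonneg _
    have n3 := fun i j k => Finset.sum_nonneg fun l (_ : l ∈ Finset.univ) => n4 i j k l
    have n2 := fun i j => Finset.sum_nonneg fun k (_ : k ∈ Finset.univ) => n3 i j k
    have n1 := fun i => Finset.sum_nonneg fun j (_ : j ∈ Finset.univ) => n2 i j
    have h1 := (Finset.sum_eq_zero_iff_of_nonneg fun i _ => n1 i).1 h i (Finset.mem_univ _)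
    have h2 := (Finset.sum_eq_zero_iff_of_nonneg fun j _ => n2 i j).1 h1 j (Finset.mem_univ _)
    have h3 := (Finset.sum_eq_zero_iff_of_nonneg fun k _ => n3 i j k).1 h2 k (Finset.mem_univ _)
    have h4 := (Finset.sum_eq_zero_iff_of_nonneg fun l _ => n4 i j k l).1 h3 l (Finset.mem_univ _)
    exact mul_self_eq_zero.1 h4
  apply Subtype.ext
  refine (e.tensorProduct e).ext fun p => (e.tensorProduct e).ext fun q => ?_
  rw [Basis.tensorProduct_apply', Basis.tensorProduct_apply']
  exact hz p.1 p.2 q.1 q.2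

lemma isCompl_invariants (e : Basis (Fin 3) ℝ V) :
    IsCompl (repZ2 e).invariants ((innerW e).orthogonal (repZ2 e).invariants) := by
  have : Module.Finite ℝ V := Module.Finite.of_basis e
  have hr : (innerW e).IsRefl := fun S T h => by rw [innerW_symm, h]
  refine (LinearMap.BilinForm.isCompl_orthogonal_iff_disjoint hr).2 ?_
  rw [Submodule.disjoint_def]
  exact fun S hS hS' => eq_zero_of_innerW_self e S (hS' S hS)

/-- The orthogonal projection `p : W → W^{ℤ₂³} ⊆ W`. -/
def proj (e : Basis (Fin 3) ℝ V) : W V →ₗ[ℝ] W V :=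
  (repZ2 e).invariants.projection ((innerW e).orthogonal (repZ2 e).invariants)
    (isCompl_invariants e)

end PositivityCone

end

/-!
Write `S_{ijkl} = S(e_i, e_j, e_k, e_l)`. An element of `W` that is invariant under the three
reflections is determined by the symmetric matrix `U_{ij} = S_{iijj}` and the numbers
`D_{ij} = S_{ijij}`, since the components with an index of odd multiplicity vanish and `τ`
identifies `S_{ijji}` with `S_{iijj}`. If `S` is positive semidefinite, then so is `U` (test on
`∑ x_i e_i ⊗ e_i`), and `|U_{ij}| ≤ D_{ij}` (test on `e_i ⊗ e_j ± e_j ⊗ e_i`).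

The averages over the group of the elastic tensors `(α ∨ β)^{⊗2} + (α ∧ β)^{⊗2}` include two
families: `diagonalGen u`, with `U = u uᵀ` and `D_{ij} = |u_i u_j|`, and `offDiagonalGen i j`, which
for `i ≠ j` has `U = 0` and only `D_{ij}` nonzero. They generate the whole invariant cone
(`mem_hull_generators`). This rests on a fact about `3 × 3` matrices
(`exists_signCoherent_of_posSemidef`): a positive semidefinite `U` is a sum of matrices `u uᵀ` such
that `|U_{ij}| = ∑ |u_i u_j|`. If `U₁₂ U₁₃ U₂₃ ≥ 0`, one step of Gaussian elimination with a
suitable pivot proves it; if the product is negative, `U` is diagonally dominant after a rescaling of the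
coordinates.

An invariant `M` takes the same value on `S` and on its average, so nonnegativity on the elastic
tensors gives nonnegativity on the whole cone, which is the equivalence of the two conditions on
`M`. The average is also the orthogonal projection `p` (`proj_eq_avg`). An extremal element of the
invariant cone is therefore a multiple of a generator (`IsExtremal.exists_generator`).

An element `S` of the third kind is, as a quadratic form, a sum of squares of three linearly
independent symmetric bilinear forms and of one nonzero alternating form
(`third_eq_sum_squares`). All four vanish on the isotropic vectors of `S`. Were `p S` a multiple of
a generator, there would be too many isotropic vectors. For `offDiagonalGen i j`, the symmetric
forms would be determined by their `ij` component. For `diagonalGen u`, the vectors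
`e_i ⊗ e_j - e_j ⊗ e_i` with `u_i u_j ≥ 0` are isotropic, so the alternating form forces some
`u_i u_j < 0`, whence `u_i u_k ≤ 0` or `u_j u_k ≤ 0` for the third index `k`; the vectors
`e_a ⊗ e_b + e_b ⊗ e_a` with `u_a u_b ≤ 0` and the diagonal vectors orthogonal to `u` are isotropic,
so the symmetric forms depend on two components only. Both contradict the independence of three
forms.
-/

open scoped TensorProduct
open Module

noncomputable section

namespace PositivityCone

variable {V : Type*} [AddCommGroup V] [Module ℝ V]

/-! ### Sign-coherent decompositions of positive semidefinite matrices -/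

/-- The `3 × 3` symmetric matrix with diagonal `a₁, a₂, a₃` and off-diagonal entries `p` (at `12`),
`q` (at `13`), `r` (at `23`) is a sum of rank-one matrices `u uᵀ` without sign cancellation: each
`|u₁ u₂|` adds up to `|p|`, and likewise for `q` and `r`. -/
def SignCoherent (a₁ a₂ a₃ p q r : ℝ) : Prop :=
  ∃ l : List (ℝ × ℝ × ℝ),
    (l.map fun u => u.1 * u.1).sum = a₁ ∧ (l.map fun u => u.2.1 * u.2.1).sum = a₂ ∧
    (l.map fun u => u.2.2 * u.2.2).sum = a₃ ∧
    (l.map fun u => u.1 * u.2.1).sum = p ∧ (l.map fun u => u.1 * u.2.2).sum = q ∧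
    (l.map fun u => u.2.1 * u.2.2).sum = r ∧
    (l.map fun u => |u.1 * u.2.1|).sum = |p| ∧ (l.map fun u => |u.1 * u.2.2|).sum = |q| ∧
    (l.map fun u => |u.2.1 * u.2.2|).sum = |r|

lemma SignCoherent.swap {a₁ a₂ a₃ p q r : ℝ} (h : SignCoherent a₂ a₁ a₃ p r q) :
    SignCoherent a₁ a₂ a₃ p q r := by
  obtain ⟨l, h1, h2, h3, h4, h5, h6, h7, h8, h9⟩ := h
  refine ⟨l.map fun u => (u.2.1, u.1, u.2.2), ?_⟩
  simp only [List.map_map, Function.comp_def]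
  refine ⟨h2, h1, h3, ?_, h6, h5, ?_, h9, h8⟩
  · simpa only [mul_comm] using h4
  · simpa only [mul_comm] using h7

/-- A positive semidefinite `2 × 2` matrix has a sign-coherent decomposition, by completing the
square. -/
lemma exists_square_completion {a b r : ℝ} (ha : 0 ≤ a) (hb : 0 ≤ b) (h : r ^ 2 ≤ a * b) :
    ∃ x y z : ℝ, x * x = a ∧ x * y = r ∧ y * y + z * z = b := by
  rcases ha.eq_or_lt with rfl | ha
  · have hr : r = 0 := by nlinarith
    exact ⟨0, 0, √b, by simp, by simp [hr], by simp [Real.mul_self_sqrt hb]⟩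
  · have hs : √a * √a = a := Real.mul_self_sqrt ha.le
    have hs0 : √a ≠ 0 := (Real.sqrt_pos.2 ha).ne'
    have hz : 0 ≤ b - r ^ 2 / a := by
      rw [sub_nonneg, div_le_iff₀ ha]
      linarith
    refine ⟨√a, r / √a, √(b - r ^ 2 / a), hs, by field_simp, ?_⟩
    rw [Real.mul_self_sqrt hz, div_mul_div_comm, hs]
    ring

lemma abs_add_abs_of_mul_nonneg {x y : ℝ} (h : 0 ≤ x * y) : |x| + |y| = |x + y| := by
  rcases mul_nonneg_iff.1 h with ⟨hx, hy⟩ | ⟨hx, hy⟩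
  · rw [abs_of_nonneg hx, abs_of_nonneg hy, abs_of_nonneg (add_nonneg hx hy)]
  · rw [abs_of_nonpos hx, abs_of_nonpos hy, abs_of_nonpos (add_nonpos hx hy)]
    ring

/-- When the off-diagonal entries have nonnegative product, eliminating the first row is
sign-coherent as soon as the Schur complement does not change the sign of `r`. -/
lemma signCoherent_of_pivot {a₁ a₂ a₃ p q r : ℝ} (h1 : 0 ≤ a₁) (h2 : 0 ≤ a₂) (h3 : 0 ≤ a₃)
    (h12 : p ^ 2 ≤ a₁ * a₂) (h13 : q ^ 2 ≤ a₁ * a₃) (h23 : r ^ 2 ≤ a₂ * a₃)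
    (hdet : 0 ≤ a₁ * a₂ * a₃ + 2 * p * q * r - a₁ * r ^ 2 - a₂ * q ^ 2 - a₃ * p ^ 2)
    (hpiv : 0 ≤ p * q * (a₁ * r - p * q)) :
    SignCoherent a₁ a₂ a₃ p q r := by
  rcases h1.eq_or_lt with rfl | h1
  · have hp : p = 0 := by nlinarith
    have hq : q = 0 := by nlinarith
    obtain ⟨x, y, z, hx, hy, hz⟩ := exists_square_completion h2 h3 h23
    exact ⟨[(0, x, y), (0, 0, z)], by simp [hx, hy, hz, hp, hq, -abs_mul]⟩
  · have hs : √a₁ * √a₁ = a₁ := Real.mul_self_sqrt h1.le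
    have hs0 : √a₁ ≠ 0 := (Real.sqrt_pos.2 h1).ne'
    have e2 : a₂ - p ^ 2 / a₁ = (a₁ * a₂ - p ^ 2) / a₁ := by field_simp
    have e3 : a₃ - q ^ 2 / a₁ = (a₁ * a₃ - q ^ 2) / a₁ := by field_simp
    have er : r - p * q / a₁ = (a₁ * r - p * q) / a₁ := by field_simp
    have k2 : 0 ≤ a₂ - p ^ 2 / a₁ := by
      rw [e2]
      exact div_nonneg (by linarith) h1.le
    have k3 : 0 ≤ a₃ - q ^ 2 / a₁ := by
      rw [e3]
      exact div_nonneg (by linarith) h1.le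
    have kr : (r - p * q / a₁) ^ 2 ≤ (a₂ - p ^ 2 / a₁) * (a₃ - q ^ 2 / a₁) := by
      rw [← sub_nonneg]
      have : (a₂ - p ^ 2 / a₁) * (a₃ - q ^ 2 / a₁) - (r - p * q / a₁) ^ 2
          = (a₁ * a₂ * a₃ + 2 * p * q * r - a₁ * r ^ 2 - a₂ * q ^ 2 - a₃ * p ^ 2) / a₁ := by
        field_simp
        ring
      rw [this]
      exact div_nonneg hdet h1.le
    obtain ⟨x, y, z, hx, hy, hz⟩ := exists_square_completion k2 k3 kr
    have m1 : √a₁ * (p / √a₁) = p := by field_simp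
    have m2 : √a₁ * (q / √a₁) = q := by field_simp
    have m3 : p / √a₁ * (p / √a₁) = p ^ 2 / a₁ := by rw [div_mul_div_comm, hs, sq]
    have m4 : q / √a₁ * (q / √a₁) = q ^ 2 / a₁ := by rw [div_mul_div_comm, hs, sq]
    have m5 : p / √a₁ * (q / √a₁) = p * q / a₁ := by rw [div_mul_div_comm, hs]
    have hab : |p * q / a₁| + |r - p * q / a₁| = |r| := by
      rw [abs_add_abs_of_mul_nonneg, add_sub_cancel]
      rw [er, div_mul_div_comm]
      exact div_nonneg hpiv (mul_self_nonneg _)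
    refine ⟨[(√a₁, p / √a₁, q / √a₁), (0, x, y), (0, 0, z)], ?_⟩
    simp [hs, m1, m2, m3, m4, m5, hx, hy, hz, hab, -abs_mul]

/-- When the off-diagonal entries have negative product, the matrix is diagonally dominant after
rescaling by a column `w` of the adjugate of the comparison matrix, so it is a sum of matrices
supported on `2 × 2` blocks. -/
lemma signCoherent_of_neg {a₁ a₂ a₃ p q r : ℝ} (h1 : 0 ≤ a₁) (h2 : 0 ≤ a₂) (h3 : 0 ≤ a₃)
    (hdet : 0 ≤ a₁ * a₂ * a₃ + 2 * p * q * r - a₁ * r ^ 2 - a₂ * q ^ 2 - a₃ * p ^ 2)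
    (hneg : p * q * r < 0) :
    SignCoherent a₁ a₂ a₃ p q r := by
  have hp : p ≠ 0 := by rintro rfl; simp at hneg
  have hq : q ≠ 0 := by rintro rfl; simp at hneg
  have hr : r ≠ 0 := by rintro rfl; simp at hneg
  have hpqr : p * q * r = -(|p| * |q| * |r|) := by
    rw [← abs_mul, ← abs_mul, abs_of_neg hneg, neg_neg]
  have P := abs_pos.2 hp
  have Q := abs_pos.2 hq
  have R := abs_pos.2 hr
  have sp := sq_abs p
  have sq' := sq_abs q
  have sr := sq_abs r
  set P' := |p| with hP'
  set Q' := |q| with hQ'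
  set R' := |r| with hR'
  set w₁ := a₂ * a₃ - R' ^ 2 with hw₁
  set w₂ := P' * a₃ + Q' * R' with hw₂
  set w₃ := P' * R' + a₂ * Q' with hw₃
  have W2 : 0 < w₂ := by positivity
  have W3 : 0 < w₃ := by positivity
  have hD : a₁ * a₂ * a₃ + 2 * p * q * r - a₁ * r ^ 2 - a₂ * q ^ 2 - a₃ * p ^ 2
      = a₁ * w₁ - P' * w₂ - Q' * w₃ := by
    rw [hw₁, hw₂, hw₃, ← sp, ← sq', ← sr]
    linear_combination 2 * hpqr
  rw [hD] at hdet
  have W1 : 0 < w₁ := by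
    have : 0 < a₁ * w₁ := by nlinarith [mul_pos P W2, mul_pos Q W3]
    exact pos_of_mul_pos_right this h1
  -- For `t² = x`, the vector `(t, c / t)` contributes `x`, `c` and `c² / x = |c| · |c| / x`.
  have key : ∀ {c C x y : ℝ}, 0 < C → C ^ 2 = c ^ 2 → 0 < x → 0 < y →
      √(C * x / y) * √(C * x / y) = C * x / y ∧
      √(C * x / y) * (c / √(C * x / y)) = c ∧
      c / √(C * x / y) * (c / √(C * x / y)) = C * y / x := by
    intro c C x y hC hc hx hy
    have h : 0 < C * x / y := by positivity
    have hs : √(C * x / y) * √(C * x / y) = C * x / y := Real.mul_self_sqrt h.le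
    have h0 : √(C * x / y) ≠ 0 := (Real.sqrt_pos.2 h).ne'
    refine ⟨hs, mul_div_cancel₀ c h0, ?_⟩
    rw [div_mul_div_comm, hs, ← sq, ← hc]
    field_simp
  obtain ⟨x1, x2, x3⟩ := key P sp W2 W1
  obtain ⟨y1, y2, y3⟩ := key Q sq' W3 W1
  obtain ⟨z1, z2, z3⟩ := key R sr W3 W2
  have hd : 0 ≤ (a₁ * w₁ - P' * w₂ - Q' * w₃) / w₁ := div_nonneg hdet W1.le
  refine ⟨[(√(P' * w₂ / w₁), p / √(P' * w₂ / w₁), 0), (√(Q' * w₃ / w₁), 0, q / √(Q' * w₃ / w₁)),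
    (0, √(R' * w₃ / w₂), r / √(R' * w₃ / w₂)),
    (√((a₁ * w₁ - P' * w₂ - Q' * w₃) / w₁), 0, 0)], ?_⟩
  simp only [List.map_cons, List.map_nil, List.sum_cons, List.sum_nil, x1, x2, x3, y1, y2, y3, z1,
    z2, z3, Real.mul_self_sqrt hd, mul_zero, zero_mul, add_zero, zero_add, abs_zero, ← hP', ← hQ',
    ← hR', and_true]
  refine ⟨?_, ?_, ?_⟩
  · field_simp
    ring
  · field_simp
    rw [hw₁, hw₂, hw₃]
    ring
  · field_simp
    rw [hw₁, hw₂, hw₃]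
    ring

/-- Every positive semidefinite `3 × 3` matrix is sign-coherent. The hypotheses are the
nonnegativity of all principal minors. -/
theorem signCoherent_of_minors {a₁ a₂ a₃ p q r : ℝ} (h1 : 0 ≤ a₁) (h2 : 0 ≤ a₂) (h3 : 0 ≤ a₃)
    (h12 : p ^ 2 ≤ a₁ * a₂) (h13 : q ^ 2 ≤ a₁ * a₃) (h23 : r ^ 2 ≤ a₂ * a₃)
    (hdet : 0 ≤ a₁ * a₂ * a₃ + 2 * p * q * r - a₁ * r ^ 2 - a₂ * q ^ 2 - a₃ * p ^ 2) :
    SignCoherent a₁ a₂ a₃ p q r := by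
  rcases lt_or_ge (p * q * r) 0 with hneg | hpos
  · exact signCoherent_of_neg h1 h2 h3 hdet hneg
  by_cases hpiv : 0 ≤ p * q * (a₁ * r - p * q)
  · exact signCoherent_of_pivot h1 h2 h3 h12 h13 h23 hdet hpiv
  · refine (signCoherent_of_pivot h2 h1 h3 (by linarith) h23 h13 (by linarith) ?_).swap
    -- Two failing pivots would give `a₁ a₂ < p²`.
    by_contra hpiv'
    push Not at hpiv hpiv'
    have A : a₁ * (p * q * r) < (p * q) ^ 2 := by linarith
    have B : a₂ * (p * q * r) < (p * r) ^ 2 := by linarith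
    have hlt : (a₁ * (p * q * r)) * (a₂ * (p * q * r)) < (p * q) ^ 2 * (p * r) ^ 2 :=
      mul_lt_mul'' A B (mul_nonneg h1 hpos) (mul_nonneg h2 hpos)
    nlinarith [mul_le_mul_of_nonneg_right h12 (sq_nonneg (p * q * r))]

/-- A positive semidefinite `3 × 3` matrix is a sum of rank-one matrices `u uᵀ` without sign
cancellation in any entry. This makes the rank-one elements suffice for the invariant cone. -/
theorem exists_signCoherent_of_posSemidef {U : Matrix (Fin 3) (Fin 3) ℝ} (hU : U.PosSemidef) :
    ∃ l : List (Fin 3 → ℝ), ∀ i j, (l.map fun u => u i * u j).sum = U i j ∧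
      (l.map fun u => |u i * u j|).sum = |U i j| := by
  have hs : ∀ i j, U i j = U j i := fun i j => by simpa using (hU.isHermitian.apply i j).symm
  have hm : ∀ i j, U i j ^ 2 ≤ U i i * U j j := by
    intro i j
    have h := (hU.submatrix ![i, j]).det_nonneg
    rw [Matrix.det_fin_two] at h
    simp only [Matrix.submatrix_apply, Matrix.cons_val_zero, Matrix.cons_val_one] at h
    rw [hs j i] at h
    linarith [sq (U i j)]
  have hd := hU.det_nonneg
  rw [Matrix.det_fin_three, hs 1 0, hs 2 0, hs 2 1] at hd
  obtain ⟨l, h1, h2, h3, h4, h5, h6, h7, h8, h9⟩ :=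
    signCoherent_of_minors hU.diag_nonneg hU.diag_nonneg hU.diag_nonneg (hm 0 1) (hm 0 2) (hm 1 2)
      (by linarith)
  refine ⟨l.map fun u => ![u.1, u.2.1, u.2.2], ?_⟩
  have hsymm : ∀ i j, ((l.map fun u => ![u.1, u.2.1, u.2.2] i * ![u.1, u.2.1, u.2.2] j).sum = U i j
      ∧ (l.map fun u => |![u.1, u.2.1, u.2.2] i * ![u.1, u.2.1, u.2.2] j|).sum = |U i j|) →
      ((l.map fun u => ![u.1, u.2.1, u.2.2] j * ![u.1, u.2.1, u.2.2] i).sum = U j i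
      ∧ (l.map fun u => |![u.1, u.2.1, u.2.2] j * ![u.1, u.2.1, u.2.2] i|).sum = |U j i|) := by
    intro i j h
    simpa only [mul_comm, hs i j] using h
  have hdiag : ∀ i, (l.map fun u => ![u.1, u.2.1, u.2.2] i * ![u.1, u.2.1, u.2.2] i).sum = U i i →
      ((l.map fun u => ![u.1, u.2.1, u.2.2] i * ![u.1, u.2.1, u.2.2] i).sum = U i i
      ∧ (l.map fun u => |![u.1, u.2.1, u.2.2] i * ![u.1, u.2.1, u.2.2] i|).sum = |U i i|) := by
    intro i h
    refine ⟨h, ?_⟩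
    simp only [abs_mul_self, h, abs_of_nonneg hU.diag_nonneg]
  simp only [List.map_map, Function.comp_def]
  intro i j
  fin_cases i <;> fin_cases j
  · exact hdiag 0 h1
  · exact ⟨h4, h7⟩
  · exact ⟨h5, h8⟩
  · exact hsymm 0 1 ⟨h4, h7⟩
  · exact hdiag 1 h2
  · exact ⟨h6, h9⟩
  · exact hsymm 0 2 ⟨h5, h8⟩
  · exact hsymm 1 2 ⟨h6, h9⟩
  · exact hdiag 2 h3

/-! ### Coordinates -/

/-- The coordinates `S(e_i, e_j, e_k, e_l)` of `S ∈ W`. -/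
def coord (e : Basis (Fin 3) ℝ V) (i j k l : Fin 3) : W V →ₗ[ℝ] ℝ where
  toFun S := (S : FourTensor V) (e i ⊗ₜ e j) (e k ⊗ₜ e l)
  map_add' _ _ := rfl
  map_smul' _ _ := rfl

lemma coord_apply (e : Basis (Fin 3) ℝ V) (i j k l : Fin 3) (S : W V) :
    coord e i j k l S = (S : FourTensor V) (e i ⊗ₜ e j) (e k ⊗ₜ e l) := rfl

lemma fourTensor_ext {S T : FourTensor V}
    (h : ∀ a b c d : V, S (a ⊗ₜ b) (c ⊗ₜ d) = T (a ⊗ₜ b) (c ⊗ₜ d)) : S = T :=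
  TensorProduct.ext' fun a b => TensorProduct.ext' fun c d => h a b c d

lemma coord_ext (e : Basis (Fin 3) ℝ V) {S T : W V}
    (h : ∀ i j k l, coord e i j k l S = coord e i j k l T) : S = T := by
  apply Subtype.ext
  refine (e.tensorProduct e).ext fun p => (e.tensorProduct e).ext fun q => ?_
  rw [Basis.tensorProduct_apply', Basis.tensorProduct_apply']
  exact h p.1 p.2 q.1 q.2

lemma W_symm (S : W V) (x y : V ⊗[ℝ] V) : (S : FourTensor V) x y = (S : FourTensor V) y x := by
  obtain ⟨A, hA, B, hB, h⟩ := Submodule.mem_sup.1 S.2.1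
  rw [← h, LinearMap.add_apply, LinearMap.add_apply, LinearMap.add_apply, LinearMap.add_apply,
    hA.1 x y, hB.1 x y]

lemma W_tau (S : W V) (a b c d : V) :
    (S : FourTensor V) (a ⊗ₜ d) (c ⊗ₜ b) = (S : FourTensor V) (a ⊗ₜ b) (c ⊗ₜ d) :=
  S.2.2 a b c d

lemma W_comm (S : W V) (a b c d : V) :
    (S : FourTensor V) (b ⊗ₜ a) (d ⊗ₜ c) = (S : FourTensor V) (a ⊗ₜ b) (c ⊗ₜ d) := by
  rw [W_tau, W_symm, W_tau]
  obtain ⟨A, ⟨hA1, hA2⟩, B, ⟨hB1, hB2⟩, h⟩ := Submodule.mem_sup.1 S.2.1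
  have key : ∀ x y, (S : FourTensor V) (TensorProduct.comm ℝ V V x) (TensorProduct.comm ℝ V V y)
      = (S : FourTensor V) x y := by
    intro x y
    simp only [← h, LinearMap.add_apply]
    rw [hA2, hB2, hA1, hB1, hA2, hB2, hA1 y x, hB1 y x, neg_neg]
  have := key (a ⊗ₜ b) (c ⊗ₜ d)
  simp only [TensorProduct.comm_tmul] at this
  rw [← this, W_tau, W_symm, W_tau]

/-! ### Elastic elements -/

@[simp] lemma tens_tmul (α β : Dual ℝ V) (a b : V) : tens α β (a ⊗ₜ b) = α a * β b := by
  simp [tens]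

lemma tensorSq_apply (φ : Dual ℝ (V ⊗[ℝ] V)) (x y : V ⊗[ℝ] V) : tensorSq φ x y = φ x * φ y := by
  simp [tensorSq]

lemma vee_comm (α β : Dual ℝ V) (x : V ⊗[ℝ] V) :
    vee α β (TensorProduct.comm ℝ V V x) = vee α β x := by
  induction x with
  | zero => simp
  | tmul a b => simp [vee]; ring
  | add a b ha hb => rw [map_add, map_add, map_add, ha, hb]

lemma wedge_comm (α β : Dual ℝ V) (x : V ⊗[ℝ] V) :
    wedge α β (TensorProduct.comm ℝ V V x) = -wedge α β x := by
  induction x with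
  | zero => simp
  | tmul a b => simp [wedge]; ring
  | add a b ha hb => rw [map_add, map_add, map_add, ha, hb]; ring

/-- The tensor `(α ∨ β)^{⊗2} + (α ∧ β)^{⊗2}` as an element of `W`, for arbitrary one-forms; for
`α = β` it is `α⁴`. -/
def elastic (α β : Dual ℝ V) : W V :=
  ⟨tensorSq (vee α β) + tensorSq (wedge α β), by
    refine ⟨Submodule.add_mem_sup ⟨fun x y => ?_, fun x y => ?_⟩ ⟨fun x y => ?_, fun x y => ?_⟩,
      fun a b c d => ?_⟩
    · simp only [tensorSq_apply, mul_comm]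
    · simp only [tensorSq_apply, vee_comm]
    · simp only [tensorSq_apply, mul_comm]
    · simp only [tensorSq_apply, wedge_comm, neg_mul]
    · simp only [LinearMap.add_apply, tensorSq_apply, vee, wedge, LinearMap.smul_apply,
        LinearMap.sub_apply, tens_tmul, smul_eq_mul]
      ring⟩

lemma elastic_tmul (α β : Dual ℝ V) (a b c d : V) :
    (elastic α β : FourTensor V) (a ⊗ₜ b) (c ⊗ₜ d)
      = (1 / 2) * (α a * β b * α c * β d + β a * α b * β c * α d) := by
  simp only [elastic, LinearMap.add_apply, tensorSq_apply, vee, wedge, LinearMap.smul_apply,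
    LinearMap.sub_apply, tens_tmul, smul_eq_mul]
  ring

lemma coord_elastic (e : Basis (Fin 3) ℝ V) (α β : Dual ℝ V) (i j k l : Fin 3) :
    coord e i j k l (elastic α β) = (1 / 2) * (α (e i) * β (e j) * α (e k) * β (e l)
      + β (e i) * α (e j) * β (e k) * α (e l)) :=
  elastic_tmul α β _ _ _ _

lemma elastic_mem_cone (α β : Dual ℝ V) : elastic α β ∈ cone V := by
  intro x
  simp only [elastic, LinearMap.add_apply, tensorSq_apply]
  exact add_nonneg (mul_self_nonneg _) (mul_self_nonneg _)

lemma symProd_self_tmul (α : Dual ℝ V) (a b c d : V) :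
    symProd ![α, α, α, α] (a ⊗ₜ b) (c ⊗ₜ d) = α a * α b * α c * α d := by
  have h : ∀ i : Fin 4, ![α, α, α, α] i = α := by
    intro i
    fin_cases i <;> rfl
  simp only [symProd, h, Finset.sum_const, Finset.card_univ, Fintype.card_perm, Fintype.card_fin,
    LinearMap.smul_apply, LinearMap.BilinForm.linMulLin_apply, tens_tmul]
  norm_num [Nat.factorial]
  ring

lemma elastic_self (α : Dual ℝ V) : (elastic α α : FourTensor V) = symProd ![α, α, α, α] := by
  refine fourTensor_ext fun a b c d => ?_
  rw [elastic_tmul, symProd_self_tmul]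
  ring

lemma SatisfiesElasticBounds.nonneg_elastic {M : Dual ℝ (W V)} (hM : SatisfiesElasticBounds M)
    (α β : Dual ℝ V) : 0 ≤ M (elastic α β) := by
  by_cases hli : LinearIndependent ℝ ![α, β]
  · exact hM _ (Or.inr ⟨α, β, hli, rfl⟩)
  -- A dependent pair gives a multiple of some `γ⁴`.
  have hself : ∀ γ : Dual ℝ V, 0 ≤ M (elastic γ γ) := by
    intro γ
    rcases eq_or_ne γ 0 with rfl | hγ
    · have : elastic (0 : Dual ℝ V) 0 = 0 :=
        Subtype.ext (fourTensor_ext fun a b c d => by rw [elastic_tmul]; simp)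
      rw [this, map_zero]
    · exact hM _ (Or.inl ⟨γ, hγ, elastic_self γ⟩)
  rcases eq_or_ne α 0 with rfl | hα
  · have : elastic 0 β = 0 :=
      Subtype.ext (fourTensor_ext fun a b c d => by rw [elastic_tmul]; simp)
    rw [this, map_zero]
  · rw [LinearIndependent.pair_iff' hα] at hli
    push Not at hli
    obtain ⟨t, rfl⟩ := hli
    have : elastic α (t • α) = t ^ 2 • elastic α α := by
      refine Subtype.ext (fourTensor_ext fun a b c d => ?_)
      rw [Submodule.coe_smul, LinearMap.smul_apply, LinearMap.smul_apply, elastic_tmul,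
        elastic_tmul]
      simp only [LinearMap.smul_apply, smul_eq_mul]
      ring
    rw [this, map_smul]
    exact mul_nonneg (sq_nonneg t) (hself α)

lemma satisfiesElasticBounds_of_mem_dualCone {M : Dual ℝ (W V)} (hM : M ∈ dualCone V) :
    SatisfiesElasticBounds M := by
  rintro S (⟨α, -, h⟩ | ⟨α, β, -, h⟩)
  · rw [show S = elastic α α from Subtype.ext (h.trans (elastic_self α).symm)]
    exact hM (elastic_mem_cone α α)
  · rw [show S = elastic α β from Subtype.ext h]
    exact hM (elastic_mem_cone α β)

/-! ### Invariants and averaging -/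

/-- The eigenvalue `±1` of `Q_m` on `e_i`. -/
def sgn (m i : Fin 3) : ℝ := if i = m then -1 else 1

lemma sgn_mul_self (m i : Fin 3) : sgn m i * sgn m i = 1 := by
  rw [sgn]
  split_ifs <;> norm_num

lemma coordReflection_apply (e : Basis (Fin 3) ℝ V) (m i : Fin 3) :
    coordReflection e m (e i) = sgn m i • e i := by
  change (e.constr ℝ fun j => if j = m then -e j else e j) (e i) = _
  rw [Basis.constr_basis, sgn]
  split_ifs <;> simp

lemma coordReflection_inv (e : Basis (Fin 3) ℝ V) (m : Fin 3) :
    (coordReflection e m)⁻¹ = coordReflection e m := by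
  rw [inv_eq_iff_mul_eq_one]
  refine e.ext' fun i => ?_
  rw [LinearEquiv.mul_apply, coordReflection_apply, map_smul, coordReflection_apply, smul_smul,
    sgn_mul_self, one_smul]
  rfl

lemma coord_rep (e : Basis (Fin 3) ℝ V) (m i j k l : Fin 3) (S : W V) :
    coord e i j k l (rep V (coordReflection e m) S)
      = sgn m i * sgn m j * sgn m k * sgn m l * coord e i j k l S := by
  have h : coord e i j k l (rep V (coordReflection e m) S) = (S : FourTensor V)
      ((coordReflection e m)⁻¹ (e i) ⊗ₜ (coordReflection e m)⁻¹ (e j))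
      ((coordReflection e m)⁻¹ (e k) ⊗ₜ (coordReflection e m)⁻¹ (e l)) := rfl
  rw [h, coordReflection_inv, coord_apply]
  simp only [coordReflection_apply, ← TensorProduct.smul_tmul', TensorProduct.tmul_smul, map_smul,
    LinearMap.smul_apply, smul_eq_mul]
  ring

lemma mem_invariants_iff (e : Basis (Fin 3) ℝ V) (S : W V) :
    S ∈ (repZ2 e).invariants ↔ ∀ m i j k l,
      sgn m i * sgn m j * sgn m k * sgn m l * coord e i j k l S = coord e i j k l S := by
  rw [Representation.mem_invariants]
  constructor
  · intro h m i j k l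
    rw [← coord_rep]
    exact congrArg _ (h ⟨coordReflection e m, Subgroup.subset_closure ⟨m, rfl⟩⟩)
  · rintro h ⟨g, hg⟩
    change rep V g S = S
    induction hg using Subgroup.closure_induction with
    | mem x hx =>
      obtain ⟨m, rfl⟩ := hx
      exact coord_ext e fun i j k l => by rw [coord_rep, h]
    | one => rw [map_one]; rfl
    | mul x y _ _ hx hy => rw [map_mul, Module.End.mul_apply, hy, hx]
    | inv x _ hx =>
      conv_lhs => rw [← hx]
      rw [← Module.End.mul_apply, ← map_mul, inv_mul_cancel, map_one]
      rfl

/-- The average of `S` and `Q_m · S`. -/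
def halfAvg (e : Basis (Fin 3) ℝ V) (m : Fin 3) : W V →ₗ[ℝ] W V :=
  (1 / 2 : ℝ) • (LinearMap.id + rep V (coordReflection e m))

/-- The average of `S` over `ℤ₂³`, as the composite of the averages over its three generators. -/
def avg (e : Basis (Fin 3) ℝ V) : W V →ₗ[ℝ] W V := halfAvg e 0 ∘ₗ halfAvg e 1 ∘ₗ halfAvg e 2

lemma coord_halfAvg (e : Basis (Fin 3) ℝ V) (m i j k l : Fin 3) (S : W V) :
    coord e i j k l (halfAvg e m S)
      = (1 + sgn m i * sgn m j * sgn m k * sgn m l) / 2 * coord e i j k l S := by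
  rw [halfAvg, LinearMap.smul_apply, LinearMap.add_apply, map_smul, map_add, coord_rep,
    LinearMap.id_apply, smul_eq_mul]
  ring

lemma coord_avg (e : Basis (Fin 3) ℝ V) (i j k l : Fin 3) (S : W V) :
    coord e i j k l (avg e S) = (1 + sgn 0 i * sgn 0 j * sgn 0 k * sgn 0 l) / 2
      * ((1 + sgn 1 i * sgn 1 j * sgn 1 k * sgn 1 l) / 2
      * ((1 + sgn 2 i * sgn 2 j * sgn 2 k * sgn 2 l) / 2 * coord e i j k l S)) := by
  rw [avg, LinearMap.comp_apply, LinearMap.comp_apply, coord_halfAvg, coord_halfAvg, coord_halfAvg]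

lemma avg_mem_invariants (e : Basis (Fin 3) ℝ V) (S : W V) : avg e S ∈ (repZ2 e).invariants := by
  rw [mem_invariants_iff]
  intro m i j k l
  have key : ∀ n, (sgn n i * sgn n j * sgn n k * sgn n l)
      * ((1 + sgn n i * sgn n j * sgn n k * sgn n l) / 2)
      = (1 + sgn n i * sgn n j * sgn n k * sgn n l) / 2 := by
    intro n
    linear_combination ((sgn n j * sgn n j) * (sgn n k * sgn n k) * (sgn n l * sgn n l) / 2)
        * sgn_mul_self n i + ((sgn n k * sgn n k) * (sgn n l * sgn n l) / 2) * sgn_mul_self n j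
      + (sgn n l * sgn n l) / 2 * sgn_mul_self n k + 1 / 2 * sgn_mul_self n l
  rw [coord_avg]
  generalize coord e i j k l S = c
  have hm : m = 0 ∨ m = 1 ∨ m = 2 := by fin_cases m <;> simp
  rcases hm with rfl | rfl | rfl
  · rw [← mul_assoc, key]
  · rw [mul_left_comm, ← mul_assoc (sgn 1 i * _ * _ * _), key]
  · rw [mul_left_comm, mul_left_comm (sgn 2 i * _ * _ * _), ← mul_assoc (sgn 2 i * _ * _ * _), key]

lemma proj_eq_avg (e : Basis (Fin 3) ℝ V) (S : W V) : proj e S = avg e S := by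
  -- A nonzero component of an invariant `T` has all sign factors `1`, and there `avg` fixes `S`.
  have horth : S - avg e S ∈ (innerW e).orthogonal (repZ2 e).invariants := by
    intro T hT
    rw [mem_invariants_iff] at hT
    change innerW e T (S - avg e S) = 0
    rw [innerW_apply]
    refine Finset.sum_eq_zero fun i _ => Finset.sum_eq_zero fun j _ => Finset.sum_eq_zero fun k _ =>
      Finset.sum_eq_zero fun l _ => ?_
    rw [← coord_apply, ← coord_apply, map_sub, coord_avg]
    linear_combination (-1 / 2 * coord e i j k l S) * hT 0 i j k l
      + (-1 / 4 * (1 + sgn 0 i * sgn 0 j * sgn 0 k * sgn 0 l) * coord e i j k l S) * hT 1 i j k l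
      + (-1 / 8 * (1 + sgn 0 i * sgn 0 j * sgn 0 k * sgn 0 l)
        * (1 + sgn 1 i * sgn 1 j * sgn 1 k * sgn 1 l) * coord e i j k l S) * hT 2 i j k l
  have h := Submodule.projection_apply_of_mem_left (isCompl_invariants e) (avg_mem_invariants e S)
  have h' := (Submodule.projection_apply_eq_zero_iff (isCompl_invariants e)).2 horth
  rw [map_sub, h, sub_eq_zero] at h'
  exact h'

lemma rep_mem_cone (g : V ≃ₗ[ℝ] V) {S : W V} (hS : S ∈ cone V) : rep V g S ∈ cone V :=
  fun _ => hS _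

lemma halfAvg_mem_cone (e : Basis (Fin 3) ℝ V) (m : Fin 3) {S : W V} (hS : S ∈ cone V) :
    halfAvg e m S ∈ cone V :=
  (cone V).smul_mem (by norm_num : (0 : ℝ) ≤ 1 / 2)
    (add_mem hS (rep_mem_cone (coordReflection e m) hS))

lemma avg_mem_invariantCone (e : Basis (Fin 3) ℝ V) {S : W V} (hS : S ∈ cone V) :
    avg e S ∈ invariantCone e :=
  ⟨halfAvg_mem_cone e 0 (halfAvg_mem_cone e 1 (halfAvg_mem_cone e 2 hS)), avg_mem_invariants e S⟩

lemma apply_avg_of_mem_invariants (e : Basis (Fin 3) ℝ V) {M : Dual ℝ (W V)}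
    (hM : M ∈ (repZ2 e).dual.invariants) (S : W V) : M (avg e S) = M S := by
  have h : ∀ m T, M (halfAvg e m T) = M T := by
    intro m T
    have h1 := (Representation.mem_invariants _ _).1 hM
      ⟨coordReflection e m, Subgroup.subset_closure ⟨m, rfl⟩⟩
    have h2 : M (rep V (coordReflection e m)⁻¹ T) = M T := LinearMap.congr_fun h1 T
    rw [coordReflection_inv] at h2
    rw [halfAvg, LinearMap.smul_apply, LinearMap.add_apply, map_smul, map_add, h2,
      LinearMap.id_apply, smul_eq_mul]
    ring
  rw [avg, LinearMap.comp_apply, LinearMap.comp_apply, h, h, h]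

/-! ### The generators of the invariant cone -/

/-- An invariant element of `W` is determined by its components `S_{iijj}` and `S_{ijij}`. -/
lemma invariant_ext (e : Basis (Fin 3) ℝ V) {P Q : W V} (hP : P ∈ (repZ2 e).invariants)
    (hQ : Q ∈ (repZ2 e).invariants) (h1 : ∀ i j, coord e i i j j P = coord e i i j j Q)
    (h2 : ∀ i j, coord e i j i j P = coord e i j i j Q) : P = Q := by
  rw [mem_invariants_iff] at hP hQ
  refine coord_ext e fun i j k l => ?_
  have odd : ∀ m, sgn m i * sgn m j * sgn m k * sgn m l = -1 →
      coord e i j k l P = coord e i j k l Q := by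
    intro m hm
    have hp := hP m i j k l
    have hq := hQ m i j k l
    rw [hm] at hp hq
    linarith
  by_cases hij : i = j
  · subst hij
    by_cases hkl : k = l
    · subst hkl
      exact h1 i k
    · exact odd k (by rw [sgn_mul_self]; simp [sgn, Ne.symm hkl])
  by_cases hki : k = i
  · subst hki
    by_cases hlj : l = j
    · subst hlj
      exact h2 k l
    · exact odd j (by simp [sgn, hij, hlj])
  by_cases hkj : k = j
  · subst hkj
    by_cases hli : l = i
    · subst hli
      rw [coord_apply, coord_apply, W_tau P, W_tau Q]
      exact h1 l k
    · exact odd i (by simp [sgn, hki, hli])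
  by_cases hlk : l = k
  · subst hlk
    exact odd i (by simp [sgn, hki, Ne.symm hij])
  · exact odd k (by simp [sgn, hlk, Ne.symm hki, Ne.symm hkj])

lemma coord_avg_iijj (e : Basis (Fin 3) ℝ V) (i j : Fin 3) (S : W V) :
    coord e i i j j (avg e S) = coord e i i j j S := by
  have h : ∀ m, sgn m i * sgn m i * sgn m j * sgn m j = 1 := fun m => by
    rw [sgn_mul_self, one_mul, sgn_mul_self]
  rw [coord_avg, h, h, h]
  ring

lemma coord_avg_ijij (e : Basis (Fin 3) ℝ V) (i j : Fin 3) (S : W V) :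
    coord e i j i j (avg e S) = coord e i j i j S := by
  have h : ∀ m, sgn m i * sgn m j * sgn m i * sgn m j = 1 := fun m => by
    rw [mul_assoc, mul_mul_mul_comm, sgn_mul_self, sgn_mul_self, one_mul]
  rw [coord_avg, h, h, h]
  ring

/-- The averaged elastic element with `S_{iijj} = u_i u_j` and `S_{ijij} = |u_i u_j|`. It comes from
one-forms `α, β` with `|α_i| = |β_i|` and `α_i β_i = u_i`; where `u_i = 0`, the quotient
`u_i / √|u_i|` is `0`, as it should be. -/
def diagonalGen (e : Basis (Fin 3) ℝ V) (u : Fin 3 → ℝ) : W V :=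
  avg e (elastic (e.constr ℝ fun i => √|u i|) (e.constr ℝ fun i => u i / √|u i|))

/-- The averaged elastic element built from the dual basis vectors `e_i*` and `e_j*`. -/
def offDiagonalGen (e : Basis (Fin 3) ℝ V) (i j : Fin 3) : W V :=
  avg e (elastic (e.coord i) (e.coord j))

lemma sqrt_abs_mul_div (x : ℝ) : √|x| * (x / √|x|) = x := by
  rcases eq_or_ne x 0 with rfl | hx
  · simp
  · exact mul_div_cancel₀ x (Real.sqrt_pos.2 (abs_pos.2 hx)).ne'

lemma div_sqrt_abs_mul_self (x : ℝ) : x / √|x| * (x / √|x|) = |x| := by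
  rw [div_mul_div_comm, Real.mul_self_sqrt (abs_nonneg x), ← abs_mul_abs_self, mul_self_div_self]

lemma coord_diagonalGen_iijj (e : Basis (Fin 3) ℝ V) (u : Fin 3 → ℝ) (i j : Fin 3) :
    coord e i i j j (diagonalGen e u) = u i * u j := by
  rw [diagonalGen, coord_avg_iijj, coord_elastic]
  simp only [Basis.constr_basis]
  linear_combination (√|u j| * (u j / √|u j|)) * sqrt_abs_mul_div (u i)
    + u i * sqrt_abs_mul_div (u j)

lemma coord_diagonalGen_ijij (e : Basis (Fin 3) ℝ V) (u : Fin 3 → ℝ) (i j : Fin 3) :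
    coord e i j i j (diagonalGen e u) = |u i * u j| := by
  rw [diagonalGen, coord_avg_ijij, coord_elastic, abs_mul]
  simp only [Basis.constr_basis]
  have h : ∀ x : ℝ, √|x| * √|x| = |x| := fun x => Real.mul_self_sqrt (abs_nonneg x)
  linear_combination (1 / 2 * (u j / √|u j| * (u j / √|u j|))) * h (u i)
    + 1 / 2 * |u i| * div_sqrt_abs_mul_self (u j)
    + (1 / 2 * (u i / √|u i| * (u i / √|u i|))) * h (u j)
    + 1 / 2 * |u j| * div_sqrt_abs_mul_self (u i)

lemma coord_offDiagonalGen_iijj (e : Basis (Fin 3) ℝ V) (a b i j : Fin 3) :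
    coord e i i j j (offDiagonalGen e a b) = if i = a ∧ i = b ∧ j = a ∧ j = b then 1 else 0 := by
  rw [offDiagonalGen, coord_avg_iijj, coord_elastic]
  simp only [Basis.coord_apply, Basis.repr_self, Finsupp.single_apply]
  split_ifs <;> grind

lemma coord_offDiagonalGen_ijij (e : Basis (Fin 3) ℝ V) (a b i j : Fin 3) :
    coord e i j i j (offDiagonalGen e a b)
      = 1 / 2 * ((if i = a ∧ j = b then 1 else 0) + (if i = b ∧ j = a then 1 else 0)) := by
  rw [offDiagonalGen, coord_avg_ijij, coord_elastic]
  simp only [Basis.coord_apply, Basis.repr_self, Finsupp.single_apply]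
  split_ifs <;> simp_all

/-- The averaged elastic elements that generate the invariant cone. -/
def generators (e : Basis (Fin 3) ℝ V) : Set (W V) :=
  Set.range (diagonalGen e) ∪ Set.range fun p : Fin 3 × Fin 3 => offDiagonalGen e p.1 p.2

lemma exists_elastic_of_mem_generators {e : Basis (Fin 3) ℝ V} {S : W V} (hS : S ∈ generators e) :
    ∃ α β, S = avg e (elastic α β) := by
  rcases hS with ⟨u, rfl⟩ | ⟨p, rfl⟩
  · exact ⟨_, _, rfl⟩
  · exact ⟨_, _, rfl⟩

lemma posSemidef_of_mem_cone (e : Basis (Fin 3) ℝ V) {S : W V} (hS : S ∈ cone V) :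
    (Matrix.of fun i j => coord e i i j j S).PosSemidef := by
  refine Matrix.PosSemidef.of_dotProduct_mulVec_nonneg ?_ fun x => ?_
  · ext i j
    simp only [Matrix.conjTranspose_apply, Matrix.of_apply, star_trivial, coord_apply]
    exact W_symm S _ _
  · have h := hS (∑ i, x i • (e i ⊗ₜ[ℝ] e i))
    simp only [map_sum, LinearMap.sum_apply, map_smul, LinearMap.smul_apply, smul_eq_mul] at h
    simp only [dotProduct, Matrix.mulVec, Matrix.of_apply, star_trivial, coord_apply]
    refine h.trans_eq ?_
    simp only [Finset.mul_sum]
    rw [Finset.sum_comm]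
    refine Finset.sum_congr rfl fun i _ => Finset.sum_congr rfl fun j _ => ?_
    ring

/-- By `τ`-invariance, the `S_{ijji}` term of the expansion is `S_{iijj}`. -/
lemma apply_add_smul_swap (e : Basis (Fin 3) ℝ V) (S : W V) (i j : Fin 3) (t : ℝ) :
    (S : FourTensor V) (e i ⊗ₜ e j + t • e j ⊗ₜ e i) (e i ⊗ₜ e j + t • e j ⊗ₜ e i)
      = (1 + t ^ 2) * coord e i j i j S + 2 * t * coord e i i j j S := by
  simp only [map_add, LinearMap.add_apply, map_smul, LinearMap.smul_apply, smul_eq_mul, coord_apply]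
  rw [W_tau S (e i) (e i) (e j) (e j), W_tau S (e j) (e j) (e i) (e i), W_comm S (e i) (e j),
    W_symm S (e j ⊗ₜ e j)]
  ring

lemma abs_coord_le (e : Basis (Fin 3) ℝ V) {S : W V} (hS : S ∈ cone V) (i j : Fin 3) :
    |coord e i i j j S| ≤ coord e i j i j S := by
  have h1 := hS (e i ⊗ₜ e j + (1 : ℝ) • e j ⊗ₜ e i)
  have h2 := hS (e i ⊗ₜ e j + (-1 : ℝ) • e j ⊗ₜ e i)
  rw [apply_add_smul_swap] at h1 h2
  exact abs_le.2 ⟨by linarith, by linarith⟩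

/-- The sign-coherent decomposition of the matrix `P_{iijj}` accounts for all of `P` except the
excesses `P_{ijij} - |P_{iijj}| ≥ 0`, which are multiples of `offDiagonalGen i j`. -/
theorem mem_hull_generators (e : Basis (Fin 3) ℝ V) {P : W V} (hP : P ∈ invariantCone e) :
    P ∈ PointedCone.hull ℝ (generators e) := by
  obtain ⟨hc, hi⟩ := hP
  obtain ⟨l, hl⟩ := exists_signCoherent_of_posSemidef (posSemidef_of_mem_cone e hc)
  simp only [Matrix.of_apply] at hl
  have hs : ∀ i j, coord e i j i j P = coord e j i j i P := fun i j =>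
    (W_comm P (e i) (e j) (e i) (e j)).symm
  have hs' : ∀ i j, coord e i i j j P = coord e j j i i P := fun i j => W_symm P _ _
  -- The sum runs over ordered pairs, each off-diagonal excess being shared by `(i, j)` and
  -- `(j, i)`; its terms with `i = j` vanish.
  have hdec : P = (l.map (diagonalGen e)).sum + ∑ i, ∑ j,
      (coord e i j i j P - |coord e i i j j P|) • offDiagonalGen e i j := by
    have hz : ∀ i, coord e i i i i P - |coord e i i i i P| = 0 := fun i =>
      sub_eq_zero.2 (abs_of_nonneg (hc _)).symm
    refine invariant_ext e hi (add_mem (list_sum_mem fun x hx => ?_)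
      (Submodule.sum_mem _ fun i _ => Submodule.sum_mem _ fun j _ =>
        Submodule.smul_mem _ _ (avg_mem_invariants e _))) (fun i j => ?_) fun i j => ?_
    · obtain ⟨u, -, rfl⟩ := List.mem_map.1 hx
      exact avg_mem_invariants e _
    · simp only [map_add, map_sum, map_smul, map_list_sum, List.map_map, Function.comp_def,
        coord_diagonalGen_iijj, coord_offDiagonalGen_iijj, (hl i j).1, smul_eq_mul]
      rw [left_eq_add]
      refine Finset.sum_eq_zero fun a _ => Finset.sum_eq_zero fun b _ => ?_
      split_ifs with h
      · obtain ⟨rfl, rfl, -⟩ := h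
        rw [hz, zero_mul]
      · rw [mul_zero]
    · simp only [map_add, map_sum, map_smul, map_list_sum, List.map_map, Function.comp_def,
        coord_diagonalGen_ijij, coord_offDiagonalGen_ijij, (hl i j).2, smul_eq_mul]
      simp only [mul_add, Finset.sum_add_distrib, ite_and, mul_ite, mul_one, mul_zero,
        Finset.sum_ite_eq, Finset.mem_univ, if_true]
      simp only [Finset.sum_ite_irrel, Finset.sum_const_zero, Finset.sum_ite_eq, Finset.mem_univ,
        if_true]
      rw [hs j i, hs' j i]
      ring
  rw [hdec]
  refine add_mem (list_sum_mem fun x hx => ?_)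
    (Submodule.sum_mem _ fun i _ => Submodule.sum_mem _ fun j _ => PointedCone.smul_mem _
      (sub_nonneg.2 (abs_coord_le e hc i j)) (PointedCone.subset_hull (Or.inr ⟨(i, j), rfl⟩)))
  obtain ⟨u, -, rfl⟩ := List.mem_map.1 hx
  exact PointedCone.subset_hull (Or.inl ⟨u, rfl⟩)

lemma generators_subset (e : Basis (Fin 3) ℝ V) : generators e ⊆ invariantCone e := by
  intro S hS
  obtain ⟨α, β, rfl⟩ := exists_elastic_of_mem_generators hS
  exact avg_mem_invariantCone e (elastic_mem_cone α β)

theorem mem_dualCone_iff_of_mem_invariants (e : Basis (Fin 3) ℝ V) {M : Dual ℝ (W V)}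
    (hM : M ∈ (repZ2 e).dual.invariants) : M ∈ dualCone V ↔ SatisfiesElasticBounds M := by
  refine ⟨satisfiesElasticBounds_of_mem_dualCone, fun h S hS => ?_⟩
  change 0 ≤ M S
  rw [← apply_avg_of_mem_invariants e hM]
  have hmem := mem_hull_generators e (avg_mem_invariantCone e hS)
  generalize avg e S = T at hmem
  induction hmem using Submodule.span_induction with
  | mem x hx =>
    obtain ⟨α, β, rfl⟩ := exists_elastic_of_mem_generators hx
    rw [apply_avg_of_mem_invariants e hM]
    exact h.nonneg_elastic α β
  | zero => rw [map_zero]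
  | add x y _ _ hx hy =>
    rw [map_add]
    exact add_nonneg hx hy
  | smul c x _ hx =>
    change 0 ≤ M ((c : ℝ) • x)
    rw [map_smul]
    exact mul_nonneg c.2 hx

/-! ### Extremal elements of a generated cone -/

/-- An extremal element of a cone is a multiple of one of its generators. -/
lemma IsExtremal.exists_generator {E : Type*} [AddCommGroup E] [Module ℝ E] {C : PointedCone ℝ E}
    {s : Set E} (hs : s ⊆ C) (hC : ∀ x ∈ C, x ∈ PointedCone.hull ℝ s) {x : E}
    (hx : IsExtremal C x) : ∃ y ∈ s, ∃ t : ℝ, 0 ≤ t ∧ x = t • y := by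
  obtain ⟨hxC, hx0, -, hface⟩ := hx
  -- If `y + z` lies on the ray, then so does `y`, as `y + z` is the midpoint of `2y` and `2z`.
  have half : ∀ y ∈ C, ∀ z ∈ C, ∀ t : ℝ, 0 ≤ t → y + z = t • x → ∃ r : ℝ, 0 ≤ r ∧ y = r • x := by
    intro y hy z hz t ht h
    obtain ⟨r, hr, h2⟩ := hface (C.smul_mem zero_le_two hy) (C.smul_mem zero_le_two hz)
      ⟨t, ht, h⟩ ⟨1 / 2, 1 / 2, by norm_num, by norm_num, by norm_num, by
        rw [smul_smul, smul_smul]; norm_num⟩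
    refine ⟨r / 2, by linarith, ?_⟩
    rw [div_eq_inv_mul, mul_smul, ← h2, smul_smul]
    norm_num
  have hull_le : ∀ y ∈ PointedCone.hull ℝ s, y ∈ C := fun y hy => Submodule.span_le.2 hs hy
  have key : ∀ z ∈ PointedCone.hull ℝ s, z ≠ 0 → (∃ t : ℝ, 0 ≤ t ∧ z = t • x) →
      ∃ y ∈ s, ∃ t : ℝ, 0 ≤ t ∧ x = t • y := by
    intro z hz
    induction hz using Submodule.span_induction with
    | mem z hz =>
      rintro hz0 ⟨t, ht, h⟩
      have ht0 : t ≠ 0 := by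
        rintro rfl
        exact hz0 (by rw [h, zero_smul])
      exact ⟨z, hz, t⁻¹, inv_nonneg.2 ht, by rw [h, inv_smul_smul₀ ht0]⟩
    | zero => exact fun h => (h rfl).elim
    | add y z hy hz ihy ihz =>
      rintro h0 ⟨t, ht, h⟩
      rcases eq_or_ne y 0 with rfl | hy0
      · rw [zero_add] at h0 h
        exact ihz h0 ⟨t, ht, h⟩
      · exact ihy hy0 (half y (hull_le y hy) z (hull_le z hz) t ht h)
    | smul c z hz ih =>
      rintro h0 ⟨t, ht, h⟩
      have h' : (c : ℝ) • z = t • x := h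
      have hc : (c : ℝ) ≠ 0 := by
        intro hc
        exact h0 (h.trans (by rw [← h', hc, zero_smul]))
      refine ih (fun hz0 => h0 (by rw [hz0, smul_zero])) ⟨t / c, div_nonneg ht c.2, ?_⟩
      rw [div_eq_inv_mul, mul_smul, ← h', inv_smul_smul₀ hc]
  exact key x (hC x hxC) hx0 ⟨1, zero_le_one, (one_smul ℝ x).symm⟩

/-! ### Elements of the third kind as sums of four squares -/

/-- The order of the terms is that of the enumeration of permutations by `decomposeFin`, which makes
the last step definitional. -/
lemma sum_perm_fin_four (f : Fin 4 → Fin 4 → Fin 4 → Fin 4 → ℝ) :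
    ∑ σ : Equiv.Perm (Fin 4), f (σ 0) (σ 1) (σ 2) (σ 3)
      = ((f 0 1 2 3 + f 0 1 3 2) + (f 0 2 1 3 + f 0 2 3 1) + (f 0 3 2 1 + f 0 3 1 2))
      + ((f 1 0 2 3 + f 1 0 3 2) + (f 1 2 0 3 + f 1 2 3 0) + (f 1 3 2 0 + f 1 3 0 2))
      + ((f 2 1 0 3 + f 2 1 3 0) + (f 2 0 1 3 + f 2 0 3 1) + (f 2 3 0 1 + f 2 3 1 0))
      + ((f 3 1 2 0 + f 3 1 0 2) + (f 3 2 1 0 + f 3 2 0 1) + (f 3 0 2 1 + f 3 0 1 2)) := by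
  simp only [Finset.univ_perm_fin_succ, Finset.sum_map, ← Finset.univ_product_univ,
    Finset.sum_product, Fin.sum_univ_four, Fin.sum_univ_three, Fin.sum_univ_two,
    Finset.univ_unique, Finset.sum_singleton]
  rfl

lemma symProd_tmul (β₀ β₁ β₂ β₃ : Dual ℝ V) (a b c d : V) :
    symProd ![β₀, β₁, β₂, β₃] (a ⊗ₜ b) (c ⊗ₜ d) = (1 / 24) * (
      β₀ a * (β₁ b * (β₂ c * β₃ d + β₃ c * β₂ d) + β₂ b * (β₁ c * β₃ d + β₃ c * β₁ d)
        + β₃ b * (β₁ c * β₂ d + β₂ c * β₁ d))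
      + β₁ a * (β₀ b * (β₂ c * β₃ d + β₃ c * β₂ d) + β₂ b * (β₀ c * β₃ d + β₃ c * β₀ d)
        + β₃ b * (β₀ c * β₂ d + β₂ c * β₀ d))
      + β₂ a * (β₀ b * (β₁ c * β₃ d + β₃ c * β₁ d) + β₁ b * (β₀ c * β₃ d + β₃ c * β₀ d)
        + β₃ b * (β₀ c * β₁ d + β₁ c * β₀ d))
      + β₃ a * (β₀ b * (β₁ c * β₂ d + β₂ c * β₁ d) + β₁ b * (β₀ c * β₂ d + β₂ c * β₀ d)
        + β₂ b * (β₀ c * β₁ d + β₁ c * β₀ d))) := by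
  have h := sum_perm_fin_four fun i j k l =>
    (![β₀, β₁, β₂, β₃] i a * ![β₀, β₁, β₂, β₃] j b)
      * (![β₀, β₁, β₂, β₃] k c * ![β₀, β₁, β₂, β₃] l d)
  simp only [symProd, LinearMap.smul_apply, LinearMap.sum_apply,
    LinearMap.BilinForm.linMulLin_apply, tens_tmul, smul_eq_mul]
  rw [h]
  simp only [Matrix.cons_val]
  ring

/-- The symmetric bilinear forms `m₁ = α₁² + α₂² + α₃²`, `m₂ = 2 α₁ ∨ α₂ + 2 d α₂ ∨ α₃ + g α₃²` and
`m₃ = 2 α₁ ∨ α₃ + d α₂² + 2 g α₂ ∨ α₃ + h α₃²`, whose squares are the symmetric part of an element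
of the third kind. -/
def thirdForm (α₁ α₂ α₃ : Dual ℝ V) (g d h : ℝ) : Fin 3 → Dual ℝ (V ⊗[ℝ] V) :=
  ![tens α₁ α₁ + tens α₂ α₂ + tens α₃ α₃,
    (2 : ℝ) • vee α₁ α₂ + (2 * d) • vee α₂ α₃ + g • tens α₃ α₃,
    (2 : ℝ) • vee α₁ α₃ + d • tens α₂ α₂ + (2 * g) • vee α₂ α₃ + h • tens α₃ α₃]

lemma vee_tmul (α β : Dual ℝ V) (a b : V) : vee α β (a ⊗ₜ b) = 1 / 2 * (α a * β b + β a * α b) := by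
  simp [vee, mul_add]

lemma wedge_tmul (α β : Dual ℝ V) (a b : V) :
    wedge α β (a ⊗ₜ b) = 1 / 2 * (α a * β b - β a * α b) := by
  simp [wedge]

/-- An element of the third kind has rank four. The inelastic term `X₂₃² + X₃₂²` splits into
`(X₂₃ + X₃₂)² / 2`, which completes the squares in the totally symmetric part, and
`(X₂₃ - X₃₂)² / 2`, the square of `α₂ ∧ α₃` up to a factor. -/
lemma third_eq_sum_squares (α₁ α₂ α₃ : Dual ℝ V) (g d h : ℝ) :
    thirdTot α₁ α₂ α₃ g d h
      + (2 * (g ^ 2 + d ^ 2 - 1 - d * h)) • (tensorSq (tens α₂ α₃) + tensorSq (tens α₃ α₂))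
    = ∑ l, tensorSq (thirdForm α₁ α₂ α₃ g d h l)
      + (4 * (g ^ 2 + d ^ 2 - 1 - d * h)) • tensorSq (wedge α₂ α₃) := by
  refine fourTensor_ext fun x y z w => ?_
  simp only [thirdTot, thirdForm, Fin.sum_univ_three, LinearMap.add_apply, LinearMap.smul_apply,
    smul_eq_mul, symProd_tmul, tensorSq_apply, Matrix.cons_val, tens_tmul, vee_tmul, wedge_tmul]
  ring

lemma exists_dual_vectors [Module.Finite ℝ V] (α : Basis (Fin 3) ℝ (Dual ℝ V)) :
    ∃ v : Fin 3 → V, ∀ i j, α i (v j) = if i = j then 1 else 0 := by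
  refine ⟨fun j => (evalEquiv ℝ V).symm (α.dualBasis j), fun i j => ?_⟩
  rw [apply_evalEquiv_symm_apply, Basis.dualBasis_apply_self]

lemma linearIndependent_thirdForm [Module.Finite ℝ V] (α : Basis (Fin 3) ℝ (Dual ℝ V))
    (g d h : ℝ) : LinearIndependent ℝ (thirdForm (α 0) (α 1) (α 2) g d h) := by
  obtain ⟨v, hv⟩ := exists_dual_vectors α
  rw [Fintype.linearIndependent_iff]
  intro c hc i
  have key : ∀ j, c 0 * thirdForm (α 0) (α 1) (α 2) g d h 0 (v 0 ⊗ₜ v j)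
      + c 1 * thirdForm (α 0) (α 1) (α 2) g d h 1 (v 0 ⊗ₜ v j)
      + c 2 * thirdForm (α 0) (α 1) (α 2) g d h 2 (v 0 ⊗ₜ v j) = 0 := by
    intro j
    simpa [Fin.sum_univ_three] using LinearMap.congr_fun hc (v 0 ⊗ₜ v j)
  -- On `v₀ ⊗ v₀`, `v₀ ⊗ v₁`, `v₀ ⊗ v₂` the three forms take the values of the identity matrix.
  have k0 := key 0
  have k1 := key 1
  have k2 := key 2
  simp [thirdForm, tens_tmul, vee_tmul, hv] at k0 k1 k2
  fin_cases i
  · exact k0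
  · exact k1
  · exact k2

/-- Three linearly independent forms have a nonzero combination that vanishes at two given points.
-/
lemma exists_combination_vanishing {E : Type*} [AddCommGroup E] [Module ℝ E]
    {m : Fin 3 → Dual ℝ E} (hm : LinearIndependent ℝ m) (x y : E) :
    ∃ c : Fin 3 → ℝ, ∑ l, c l • m l ≠ 0 ∧ (∑ l, c l • m l) x = 0 ∧ (∑ l, c l • m l) y = 0 := by
  let f : (Fin 3 → ℝ) →ₗ[ℝ] ℝ × ℝ :=
    ((LinearMap.applyₗ x).prod (LinearMap.applyₗ y)) ∘ₗ Fintype.linearCombination ℝ m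
  have hf : LinearMap.ker f ≠ ⊥ := LinearMap.ker_ne_bot_of_finrank_lt (by simp)
  obtain ⟨c, hc, hc0⟩ := Submodule.exists_mem_ne_zero_of_ne_bot hf
  have h := Prod.ext_iff.1 (LinearMap.mem_ker.1 hc)
  refine ⟨c, fun h0 => hc0 (funext (Fintype.linearIndependent_iff.1 hm c h0)), h.1, h.2⟩

lemma thirdForm_swap (α₁ α₂ α₃ : Dual ℝ V) (g d h : ℝ) (l : Fin 3) (a b : V) :
    thirdForm α₁ α₂ α₃ g d h l (a ⊗ₜ b) = thirdForm α₁ α₂ α₃ g d h l (b ⊗ₜ a) := by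
  fin_cases l <;> simp [thirdForm, tens_tmul, vee_tmul] <;> ring

/-- An element of the third kind is a sum of squares of three independent symmetric forms and of
an alternating one. Hence the symmetric forms that vanish on its isotropic vectors are at
least three-dimensional: two further linear conditions can be imposed. -/
lemma IsThirdKind.exists_symm_form [Module.Finite ℝ V] {S : FourTensor V} (hS : IsThirdKind S)
    (x y : V ⊗[ℝ] V) : ∃ φ : Dual ℝ (V ⊗[ℝ] V), φ ≠ 0 ∧ (∀ a b, φ (a ⊗ₜ b) = φ (b ⊗ₜ a)) ∧
      (∀ z, S z z = 0 → φ z = 0) ∧ φ x = 0 ∧ φ y = 0 := by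
  obtain ⟨α, g, d, h, hpos, rfl⟩ := hS
  obtain ⟨c, hc, hx, hy⟩ := exists_combination_vanishing (linearIndependent_thirdForm α g d h) x y
  refine ⟨_, hc, fun a b => ?_, fun z hz => ?_, hx, hy⟩
  · simp only [LinearMap.sum_apply, LinearMap.smul_apply, thirdForm_swap _ _ _ _ _ _ _ a b]
  · rw [third_eq_sum_squares] at hz
    simp only [LinearMap.add_apply, LinearMap.sum_apply, LinearMap.smul_apply, tensorSq_apply,
      smul_eq_mul] at hz
    have h2 := mul_nonneg (by linarith : 0 ≤ 4 * (g ^ 2 + d ^ 2 - 1 - d * h))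
      (mul_self_nonneg (wedge (α 1) (α 2) z))
    have h1 : ∀ l ∈ Finset.univ, 0 ≤ thirdForm (α 0) (α 1) (α 2) g d h l z
        * thirdForm (α 0) (α 1) (α 2) g d h l z := fun l _ => mul_self_nonneg _
    have h3 := (Finset.sum_eq_zero_iff_of_nonneg h1).1 (by linarith [Finset.sum_nonneg h1])
    simp only [LinearMap.sum_apply, LinearMap.smul_apply]
    exact Finset.sum_eq_zero fun l hl => by rw [mul_self_eq_zero.1 (h3 l hl), smul_zero]

lemma IsThirdKind.exists_alternating_form [Module.Finite ℝ V] {S : FourTensor V}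
    (hS : IsThirdKind S) : ∃ φ : Dual ℝ (V ⊗[ℝ] V), φ ≠ 0 ∧ (∀ a b, φ (a ⊗ₜ b) = -φ (b ⊗ₜ a)) ∧
      ∀ z, S z z = 0 → φ z = 0 := by
  obtain ⟨α, g, d, h, hpos, rfl⟩ := hS
  refine ⟨wedge (α 1) (α 2), fun h0 => ?_, fun a b => ?_, fun z hz => ?_⟩
  · obtain ⟨v, hv⟩ := exists_dual_vectors α
    have := LinearMap.congr_fun h0 (v 1 ⊗ₜ v 2)
    simp [wedge_tmul, hv] at this
  · rw [wedge_tmul, wedge_tmul]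
    ring
  · rw [third_eq_sum_squares] at hz
    simp only [LinearMap.add_apply, LinearMap.sum_apply, LinearMap.smul_apply, tensorSq_apply,
      smul_eq_mul] at hz
    have hC : 0 < 4 * (g ^ 2 + d ^ 2 - 1 - d * h) := by linarith
    have h1 : 0 ≤ ∑ l, thirdForm (α 0) (α 1) (α 2) g d h l z
        * thirdForm (α 0) (α 1) (α 2) g d h l z := Finset.sum_nonneg fun l _ => mul_self_nonneg _
    have h2 := mul_nonneg hC.le (mul_self_nonneg (wedge (α 1) (α 2) z))
    exact mul_self_eq_zero.1 ((mul_eq_zero.1 (by linarith)).resolve_left hC.ne')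

/-! ### Projections of third-kind elements are not extremal -/

lemma form_eq_zero (e : Basis (Fin 3) ℝ V) {φ : Dual ℝ (V ⊗[ℝ] V)}
    (h : ∀ i j, φ (e i ⊗ₜ e j) = 0) : φ = 0 := by
  refine (e.tensorProduct e).ext fun p => ?_
  rw [Basis.tensorProduct_apply']
  exact h p.1 p.2

/-- A third-kind element does not project to a multiple of `offDiagonalGen`: the symmetric forms
that vanish on its isotropic vectors would be determined by one component. -/
lemma IsThirdKind.avg_ne_smul_offDiagonalGen (e : Basis (Fin 3) ℝ V) {S : W V}
    (hS : IsThirdKind (S : FourTensor V)) (t : ℝ) (a b : Fin 3) :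
    avg e S ≠ t • offDiagonalGen e a b := by
  intro h
  have : Module.Finite ℝ V := Module.Finite.of_basis e
  obtain ⟨φ, hφ, hsymm, hker, hab, -⟩ := hS.exists_symm_form (e a ⊗ₜ e b) 0
  refine hφ (form_eq_zero e fun i j => ?_)
  by_cases h1 : i = a ∧ j = b
  · rw [h1.1, h1.2, hab]
  by_cases h2 : i = b ∧ j = a
  · rw [h2.1, h2.2, hsymm, hab]
  apply hker
  rw [← coord_apply, ← coord_avg_ijij, h, map_smul, coord_offDiagonalGen_ijij, if_neg h1, if_neg h2]
  simp

/-- A third-kind element does not project to a nonnegative multiple of `diagonalGen u`. Its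
alternating form forces `u_i u_j < 0` for some `i, j`; then the symmetric forms that vanish on its
isotropic vectors are determined by two components. -/
lemma IsThirdKind.avg_ne_smul_diagonalGen (e : Basis (Fin 3) ℝ V) {S : W V}
    (hS : IsThirdKind (S : FourTensor V)) (t : ℝ) (u : Fin 3 → ℝ) :
    avg e S ≠ t • diagonalGen e u := by
  intro h
  have : Module.Finite ℝ V := Module.Finite.of_basis e
  have hU : ∀ i j, coord e i i j j S = t * (u i * u j) := fun i j => by
    rw [← coord_avg_iijj, h, map_smul, coord_diagonalGen_iijj, smul_eq_mul]
  have hD : ∀ i j, coord e i j i j S = t * |u i * u j| := fun i j => by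
    rw [← coord_avg_ijij, h, map_smul, coord_diagonalGen_ijij, smul_eq_mul]
  have main : ∀ i j k, (∀ l, l = i ∨ l = j ∨ l = k) → u i * u j < 0 → u i * u k ≤ 0 → False := by
    intro i j k hijk hij hik
    obtain ⟨φ, hφ, hsymm, hker, hii, hjk⟩ := hS.exists_symm_form (e i ⊗ₜ e i) (e j ⊗ₜ e k)
    have hoff : ∀ a b, u a * u b ≤ 0 → φ (e a ⊗ₜ e b) = 0 := by
      intro a b hab
      have h1 := hker (e a ⊗ₜ e b + (1 : ℝ) • e b ⊗ₜ e a) (by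
        rw [apply_add_smul_swap, hU, hD, abs_of_nonpos hab]
        ring)
      rw [map_add, map_smul, one_smul, hsymm (e b)] at h1
      linarith
    have hdiag : ∀ a, φ (e a ⊗ₜ e a) = 0 := by
      intro a
      have h1 := hker (u i • e a ⊗ₜ e a - u a • e i ⊗ₜ e i) (by
        simp only [map_sub, LinearMap.sub_apply, map_smul, LinearMap.smul_apply, smul_eq_mul,
          ← coord_apply, hU]
        ring)
      rw [map_sub, map_smul, map_smul, hii, smul_zero, sub_zero, smul_eq_mul] at h1
      refine (mul_eq_zero.1 h1).resolve_left fun h0 => ?_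
      rw [h0, zero_mul] at hij
      exact lt_irrefl _ hij
    refine hφ (form_eq_zero e fun a b => ?_)
    rcases hijk a with rfl | rfl | rfl <;> rcases hijk b with rfl | rfl | rfl
    · exact hii
    · exact hoff _ _ hij.le
    · exact hoff _ _ hik
    · rw [hsymm]
      exact hoff _ _ hij.le
    · exact hdiag _
    · exact hjk
    · rw [hsymm]
      exact hoff _ _ hik
    · rw [hsymm]
      exact hjk
    · exact hdiag _
  obtain ⟨A, hA, halt, hker⟩ := hS.exists_alternating_form
  obtain ⟨i, j, hij⟩ : ∃ i j, A (e i ⊗ₜ e j) ≠ 0 := by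
    by_contra! hc
    exact hA (form_eq_zero e hc)
  have hneg : u i * u j < 0 := by
    by_contra! hc
    have h1 := hker (e i ⊗ₜ e j + (-1 : ℝ) • e j ⊗ₜ e i) (by
      rw [apply_add_smul_swap, hU, hD, abs_of_nonneg hc]
      ring)
    rw [map_add, map_smul, halt (e j), smul_eq_mul] at h1
    exact hij (by linarith)
  have hne : i ≠ j := by
    rintro rfl
    exact absurd (mul_self_nonneg (u i)) (not_le.2 hneg)
  obtain ⟨k, hk⟩ : ∃ k, ∀ l, l = i ∨ l = j ∨ l = k :=
    (by decide : ∀ i j : Fin 3, i ≠ j → ∃ k, ∀ l, l = i ∨ l = j ∨ l = k) i j hne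
  rcases le_or_gt (u i * u k) 0 with hik | hik
  · exact main i j k hk hneg hik
  · refine main j i k (fun l => or_left_comm.1 (hk l)) (by linarith [mul_comm (u i) (u j)]) ?_
    by_contra! hjk
    nlinarith [mul_pos hik hjk, mul_nonneg (neg_nonneg.2 hneg.le) (mul_self_nonneg (u k))]

theorem not_isExtremal_proj_of_isThirdKind (e : Basis (Fin 3) ℝ V) {S : W V}
    (hS : IsThirdKind (S : FourTensor V)) : ¬ IsExtremal (invariantCone e) (proj e S) := by
  intro hext
  rw [proj_eq_avg] at hext
  obtain ⟨G, hG, t, -, ht⟩ :=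
    hext.exists_generator (generators_subset e) fun x hx => mem_hull_generators e hx
  rcases hG with ⟨u, rfl⟩ | ⟨p, rfl⟩
  · exact hS.avg_ne_smul_diagonalGen e t u ht
  · exact hS.avg_ne_smul_offDiagonalGen e t p.1 p.2 ht

end PositivityCone

end

theorem mainTheorem3 {V : Type*} [AddCommGroup V] [Module ℝ V] (e : Module.Basis (Fin 3) ℝ V) :
    (∀ M : Module.Dual ℝ (PositivityCone.W V),
      M ∈ (PositivityCone.repZ2 e).dual.invariants →
        (M ∈ PositivityCone.dualCone V ↔ PositivityCone.SatisfiesElasticBounds M)) ∧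
    (∀ S : PositivityCone.W V,
      PositivityCone.IsThirdKind (S : PositivityCone.FourTensor V) →
        ¬ PositivityCone.IsExtremal (PositivityCone.invariantCone e)
          (PositivityCone.proj e S)) :=
  ⟨fun _ hM => PositivityCone.mem_dualCone_iff_of_mem_invariants e hM,
    fun _ hS => PositivityCone.not_isExtremal_proj_of_isThirdKind e hS⟩
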